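/- Define integers $T^3(n,k)$, $0\le k\le n$, by $T^3(0,0)=1$, $T^3(n,n)=0$ for $n>0$, and $$T^3(n,k)=\sum_{j=0}^{k}(k-j+1)\,T^3(n-1,j)\qquad(n>0,\ 0\le k<n).$$ In the standard arc diagram of a set partition $P$ of $[n]$, one places $n$ points on the boundary line of a closed half-plane, in the order $1,\dots,n$, and joins $i<j$ by an arc (a semicircle in the half-plane) exactly when $i$ and $j$ are consecutive elements of a block of $P$. The partition is planar (noncrossing) if no two arcs cross. A double planar partition of $[n]$ is a pair $(P_1,P_2)$ of planar partitions of $[n]$ such that every block of $P_1$ is contained in a block of $P_2$. Its diagram of arcs and ties consists of the $n$ points, the arcs of $P_1$, and ties (drawn as further semicircles) connecting the blocks of $P_1$ that lie in the same block of $P_2$: whenever $j$ is the least element of its $P_1$-block but not the least element of its $P_2$-block, a tie joins $j$ to the element immediately preceding $j$ in its $P_2$-block. Let $U$ be the unbounded region of the complement of the diagram in the half-plane. The boxes of the diagram are the connected components of the complement of $U$ in the half-plane, that is, of the union of the points, the arcs, the ties and the bounded regions. Then for all $n\ge 0$ and $0\le k\le n$, the number of double planar partitions of $[n]$ whose diagrams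 have exactly $n-k$ boxes is $T^3(n,k)$. Moreover, the total number of double planar partitions of $[n]$ is the Fuss–Catalan number $$A^3_n=\frac{1}{3n+1}\binom{3n+1}{n}.$$ -/

import Mathlib

/-- The triangle `T^p(n,k)` (`p > 0`), extended by `0` to `k > n`:
`T^p(0,0) = 1`, `T^p(n,n) = 0` for `n > 0`, and
`T^p(n,k) = ∑_{j=0}^{k} binom(k-j+p-2, p-2) T^p(n-1,j)` for `0 ≤ k < n`.
The binomial coefficient is written in the symmetric form `binom(k-j+p-2, k-j)`,
which for `p = 1` is `1` if `j = k` and `0` otherwise. -/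
def fussCatalanTriangle (p : ℕ) : ℕ → ℕ → ℕ
  | 0, k => if k = 0 then 1 else 0
  | n + 1, k =>
      if k < n + 1 then
        ∑ j ∈ Finset.range (k + 1),
          (k - j + p - 2).choose (k - j) * fussCatalanTriangle p n j
      else 0

/-- The Fuss-Catalan number `A^p_n = binom(pn+1, n) / (pn+1)`. -/
def fussCatalan (p n : ℕ) : ℚ :=
  ((p * n + 1).choose n : ℚ) / ((p : ℚ) * n + 1)

/- Set partitions of an `n`-element linearly ordered set are equivalence relations on `Fin n`;
the blocks are the equivalence classes, and `P ≤ Q` says that `P` refines `Q`. -/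

/-- `i` and `j` are joined by an arc in the standard arc diagram of `P`: they are consecutive
elements of a block. -/
def IsArc {n : ℕ} (P : Setoid (Fin n)) (i j : Fin n) : Prop :=
  i < j ∧ P i j ∧ ∀ k, i < k → k < j → ¬ P i k

/-- `P` is planar: no two arcs of its standard diagram cross. -/
def IsPlanar {n : ℕ} (P : Setoid (Fin n)) : Prop :=
  ∀ a b c d : Fin n, IsArc P a b → IsArc P c d → ¬ (a < c ∧ c < b ∧ b < d)

/-- A double planar partition: two planar partitions, the first one refining the second one. -/
structure DoublePlanarPartition (n : ℕ) where
  fst : Setoid (Fin n)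
  snd : Setoid (Fin n)
  fst_planar : IsPlanar fst
  snd_planar : IsPlanar snd
  refines : fst ≤ snd

/-- The ties of the standard diagram of arcs and ties of `(P, Q)`. If `j` is the least element of
its `P`-block, but not of its `Q`-block, then a tie joins `j` to the element `i` that precedes it
in its `Q`-block (`i` and `j` lie in different `P`-blocks). Two `P`-blocks lie in the same
`Q`-block if and only if a chain of ties links them, and no tie is redundant. -/
def IsTie {n : ℕ} (P Q : Setoid (Fin n)) (i j : Fin n) : Prop :=
  IsArc Q i j ∧ ∀ k, P k j → j ≤ k

/-- The closed half-plane in which diagrams are drawn. -/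
def halfPlane : Set ℂ := {z | 0 ≤ z.im}

/-- The semicircle in the half-plane with end points `a < b` on the boundary line. -/
def semicircle (a b : ℝ) : Set ℂ :=
  {z | z ∈ halfPlane ∧ dist z (((a + b) / 2 : ℝ) : ℂ) = (b - a) / 2}

/-- Given a set `D` drawn in the half-plane: the union `U` of the unbounded regions, i.e. of the
unbounded connected components of the complement of `D` in the half-plane. -/
def outerRegion (D : Set ℂ) : Set ℂ :=
  {z | z ∈ halfPlane \ D ∧ ¬ Bornology.IsBounded (connectedComponentIn (halfPlane \ D) z)}

/-- The boxes of a drawing `D`: the connected components of the complement of `U` in the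
half-plane, this complement being the union of the points, the arcs, the ties and the bounded
regions. -/
def boxes (D : Set ℂ) : Set (Set ℂ) :=
  (fun z => connectedComponentIn (halfPlane \ outerRegion D) z) '' (halfPlane \ outerRegion D)

/-- The diagram of arcs and ties of a double planar partition, drawn in the half-plane: the `n`
points on the boundary line, a semicircle for every arc and a semicircle for every tie. -/
def DoublePlanarPartition.diagram {n : ℕ} (R : DoublePlanarPartition n) : Set ℂ :=
  {z | ∃ i : Fin n, z = ((i : ℕ) : ℂ)} ∪
    {z | ∃ i j : Fin n, (IsArc R.fst i j ∨ IsTie R.fst R.snd i j) ∧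
      z ∈ semicircle ((i : ℕ) : ℝ) ((j : ℕ) : ℝ)}

/-!
The boxes fill up the half discs below the arcs and ties, so two points lie in the same box exactly
when each gap between them is spanned by an arc or a tie. The gap before `k` is spanned by an arc or
a tie if and only if it is bridged by a block of the coarser partition. So the boxes correspond to
the *cuts* of that partition, the points whose preceding gap is not bridged by any block.

Let `s` and `p` be the least elements of the two blocks of the last point of a double planar
partition `(P₁, P₂)` of `n + 1` points, so that `s ≤ p`. Cutting `P₁` before `p` and the last point,
and `P₂` before `s`, `p` and the last point, leaves a double planar partition of `n` points in which
`s` and `p` are cuts, the new last point being allowed as a cut too. Merging the blocks that start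
at these places undoes this, so double planar partitions of `n + 1` points amount to those of `n`
points with a pair `s ≤ p` of cuts. The cuts that survive the merging are those up to `s`. Hence a
partition with `c` cuts has `c + 2 - m` extensions with `m > 0` cuts, which is the recursion of the
triangle.

The entries of the triangle are Raney numbers, `T^p(m + k, k) = raney p ((p - 1) * m) k`, because
these satisfy a convolution identity of the same shape as the recursion; one more use of it sums a
row of the triangle to a Fuss-Catalan number.
-/

section Cuts

variable {α : Type*} {P Q : Setoid α} {A B : Set α} {k s t x y z : α}

/-- The points `k` such that no pair related by `r` bridges the gap just before `k`. -/
def cuts [LT α] (r : α → α → Prop) : Set α :=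
  {k | ∀ ⦃x y⦄, r x y → x < k → y < k}

theorem lt_iff_lt_of_mem_cuts [LT α] (hk : k ∈ cuts P) (hxy : P x y) :
    x < k ↔ y < k :=
  ⟨hk hxy, hk (P.symm' hxy)⟩

theorem cuts_anti [LT α] (hPQ : P ≤ Q) : cuts Q ⊆ cuts P :=
  fun _ hk _ _ hxy => hk (hPQ hxy)

theorem le_of_mem_cuts [LinearOrder α] (hk : k ∈ cuts P) (hxk : P x k) :
    k ≤ x :=
  not_lt.1 fun hlt => lt_irrefl k (hk hxk hlt)

/-- No two blocks cross; for partitions of `Fin n` this is planarity, see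
`isPlanar_iff_isNoncrossing`. -/
def IsNoncrossing [LT α] (P : Setoid α) : Prop :=
  ∀ ⦃a b c d⦄, a < b → b < c → c < d → P a c → P b d → P a b

/-- Merge the blocks of `P` that meet `A` into a single one. -/
def mergeAt (P : Setoid α) (A : Set α) : Setoid α where
  r x y := P x y ∨ (∃ a ∈ A, P x a) ∧ ∃ a ∈ A, P y a
  iseqv :=
    { refl := fun x => .inl (P.refl' x)
      symm := Or.imp P.symm' And.symm
      trans := by
        rintro x y z (hxy | ⟨hx, a, ha, hya⟩) (hyz | ⟨⟨b, hb, hyb⟩, hz⟩)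
        · exact .inl (P.trans' hxy hyz)
        · exact .inr ⟨⟨b, hb, P.trans' hxy hyb⟩, hz⟩
        · exact .inr ⟨hx, a, ha, P.trans' (P.symm' hyz) hya⟩
        · exact .inr ⟨hx, hz⟩ }

theorem mergeAt_apply : mergeAt P A x y ↔ P x y ∨ (∃ a ∈ A, P x a) ∧ ∃ a ∈ A, P y a :=
  Iff.rfl

theorem mergeAt_apply_of_mem (ht : t ∈ A) : mergeAt P A x t ↔ ∃ a ∈ A, P x a :=
  ⟨fun h => h.elim (fun hxt => ⟨t, ht, hxt⟩) And.left, fun h => .inr ⟨h, t, ht, P.refl' t⟩⟩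

theorem le_mergeAt : P ≤ mergeAt P A := fun _ _ => .inl

theorem mergeAt_mono (hPQ : P ≤ Q) (hAB : A ⊆ B) : mergeAt P A ≤ mergeAt Q B :=
  fun _ _ => Or.imp (@hPQ _ _) (And.imp (fun ⟨a, ha, h⟩ => ⟨a, hAB ha, hPQ h⟩)
    fun ⟨a, ha, h⟩ => ⟨a, hAB ha, hPQ h⟩)

variable [LinearOrder α]

theorem IsNoncrossing.isLeast_mem_cuts [OrderTop α] (hP : IsNoncrossing P)
    (hs : IsLeast {x | P x ⊤} s) : s ∈ cuts P := by
  intro x y hxy hxs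
  by_contra! hsy
  refine hxs.not_ge (hs.2 ?_)
  rcases hsy.eq_or_lt with rfl | hsy
  · exact P.trans' hxy hs.1
  rcases (le_top (a := y)).eq_or_lt with rfl | hy
  · exact hxy
  · exact P.trans' (hP hxs hsy hy hxy hs.1) hs.1

theorem IsNoncrossing.rel_of_mem_cuts (hP : IsNoncrossing P) (ht : t ∈ cuts P) (hxy : x < y)
    (hyz : y < z) (hxz : P x z) (hyt : P y t) : P x t := by
  have htz : t < z := (le_of_mem_cuts ht hyt).trans_lt hyz
  have htx : t ≤ x := not_lt.1 fun hxt => (ht hxz hxt).not_gt htz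
  rcases htx.eq_or_lt with rfl | htx
  · exact P.refl' t
  · exact P.symm' (hP htx hxy hyz (P.symm' hyt) hxz)

/-- Cut every block of `P` just before each point of `A`. -/
def cutAt (P : Setoid α) (A : Set α) : Setoid α :=
  P ⊓ Setoid.ker fun x => {a ∈ A | x < a}

theorem cutAt_apply : cutAt P A x y ↔ P x y ∧ ∀ a ∈ A, (x < a ↔ y < a) := by
  rw [cutAt, Setoid.inf_iff_and, Setoid.ker_def, Set.ext_iff]
  exact and_congr_right' (forall_congr' fun a => and_congr_right_iff)

theorem cutAt_le : cutAt P A ≤ P := inf_le_left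

theorem subset_cuts_cutAt : A ⊆ cuts (cutAt P A) :=
  fun _ ha _ _ hxy => ((cutAt_apply.1 hxy).2 _ ha).1

theorem cutAt_le_cutAt (hPQ : P ≤ Q) (hB : B ⊆ A ∪ cuts Q) : cutAt P A ≤ cutAt Q B := by
  intro x y hxy
  obtain ⟨hP, hA⟩ := cutAt_apply.1 hxy
  exact cutAt_apply.2 ⟨hPQ hP, fun b hb =>
    (hB hb).elim (hA b) fun hcut => lt_iff_lt_of_mem_cuts hcut (hPQ hP)⟩

theorem IsNoncrossing.cutAt (hP : IsNoncrossing P) : IsNoncrossing (cutAt P A) := by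
  intro a b c d hab hbc hcd hac hbd
  rw [cutAt_apply] at hac hbd ⊢
  exact ⟨hP hab hbc hcd hac.1 hbd.1,
    fun t ht => ⟨fun hat => hbc.trans ((hac.2 t ht).1 hat), hab.trans⟩⟩

theorem IsNoncrossing.mergeAt (hP : IsNoncrossing P) (hA : A ⊆ cuts P) :
    IsNoncrossing (mergeAt P A) := by
  rintro a b c d hab hbc hcd (hac | ⟨ha, t, ht, hct⟩) (hbd | ⟨⟨u, hu, hbu⟩, -⟩)
  · exact .inl (hP hab hbc hcd hac hbd)
  · exact .inr ⟨⟨u, hu, hP.rel_of_mem_cuts (hA hu) hab hbc hac hbu⟩, u, hu, hbu⟩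
  · exact .inr ⟨ha, t, ht, hP.rel_of_mem_cuts (hA ht) hbc hcd hbd hct⟩
  · exact .inr ⟨ha, u, hu, hbu⟩

theorem cutAt_mergeAt (hA : A ⊆ cuts P) : cutAt (mergeAt P A) A = P := by
  ext x y
  rw [cutAt_apply, mergeAt_apply]
  refine ⟨?_, fun h => ⟨.inl h, fun a ha => lt_iff_lt_of_mem_cuts (hA ha) h⟩⟩
  rintro ⟨h | ⟨⟨a, ha, hxa⟩, b, hb, hyb⟩, hside⟩
  · exact h
  have hay : a ≤ y := not_lt.1 <| (hside a ha).not.1 (le_of_mem_cuts (hA ha) hxa).not_gt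
  have hbx : b ≤ x := not_lt.1 <| (hside b hb).not.2 (le_of_mem_cuts (hA hb) hyb).not_gt
  have hab : a ≤ b := not_lt.1 <| (lt_iff_lt_of_mem_cuts (hA ha) hyb).not.1 hay.not_gt
  have hba : b ≤ a := not_lt.1 <| (lt_iff_lt_of_mem_cuts (hA hb) hxa).not.1 hbx.not_gt
  obtain rfl := hab.antisymm hba
  exact P.trans' hxa (P.symm' hyb)

theorem exists_cutAt_of_le (hA : A.Finite) (hs : s ∈ A) (hAt : ∀ a ∈ A, P a t)
    (hxt : P x t) (hsx : s ≤ x) : ∃ a ∈ A, cutAt P A x a := by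
  obtain ⟨a, ⟨ha, hax⟩, hmax⟩ :=
    Set.exists_max_image {a ∈ A | a ≤ x} id (hA.sep _) ⟨s, hs, hsx⟩
  refine ⟨a, ha, cutAt_apply.2 ⟨P.trans' hxt (P.symm' (hAt a ha)), fun b hb => ?_⟩⟩
  exact ⟨hax.trans_lt, fun hab => not_le.1 fun hbx => (hmax b ⟨hb, hbx⟩).not_gt hab⟩

theorem mergeAt_cutAt [OrderTop α] (hP : IsNoncrossing P) (hA : A.Finite)
    (hAtop : ∀ a ∈ A, P a ⊤) (hs : IsLeast {x | P x ⊤} s) (hsA : s ∈ A) :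
    mergeAt (cutAt P A) A = P := by
  have hblock (x : α) : (∃ a ∈ A, cutAt P A x a) ↔ P x ⊤ :=
    ⟨fun ⟨a, ha, hxa⟩ => P.trans' (cutAt_le hxa) (hAtop a ha),
      fun hx => exists_cutAt_of_le hA hsA hAtop hx (hs.2 hx)⟩
  have hside {x y} (hxy : P x y) (hy : ¬ P y ⊤) (a) (ha : a ∈ A) (hxa : x < a) : y < a := by
    by_contra! hay
    rcases hay.eq_or_lt with rfl | hay
    · exact hy (hAtop a ha)
    have hytop : y < ⊤ := lt_top_iff_ne_top.2 fun h => hy (h ▸ P.refl' y)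
    have hxa' : P x a := hP hxa hay hytop hxy (hAtop a ha)
    exact hy (P.trans' (P.symm' hxy) (P.trans' hxa' (hAtop a ha)))
  ext x y
  rw [mergeAt_apply, hblock, hblock]
  constructor
  · rintro (hxy | ⟨hx, hy⟩)
    · exact cutAt_le hxy
    · exact P.trans' hx (P.symm' hy)
  · intro hxy
    by_cases hy : P y ⊤
    · exact .inr ⟨P.trans' hxy hy, hy⟩
    · have hx : ¬ P x ⊤ := fun hx => hy (P.trans' (P.symm' hxy) hx)
      exact .inl (cutAt_apply.2
        ⟨hxy, fun a ha => ⟨hside hxy hy a ha, hside (P.symm' hxy) hx a ha⟩⟩)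

theorem le_of_mergeAt (hA : A ⊆ cuts P) (hs : s ∈ lowerBounds A) (ht : t ∈ A)
    (hxt : mergeAt P A x t) : s ≤ x := by
  obtain ⟨a, ha, hxa⟩ := (mergeAt_apply_of_mem ht).1 hxt
  exact (hs ha).trans (le_of_mem_cuts (hA ha) hxa)

theorem isLeast_mergeAt (hA : A ⊆ cuts P) (hs : IsLeast A s) (ht : t ∈ A) :
    IsLeast {x | mergeAt P A x t} s :=
  ⟨(mergeAt_apply_of_mem ht).2 ⟨s, hs.1, P.refl' s⟩, fun _ => le_of_mergeAt hA hs.2 ht⟩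

theorem cuts_mergeAt [OrderTop α] (hA : A ⊆ cuts P) (hs : IsLeast A s) (htop : ⊤ ∈ A) :
    cuts (mergeAt P A) = cuts P ∩ Set.Iic s := by
  have hleast := isLeast_mergeAt hA hs htop
  ext k
  constructor
  · refine fun hk => ⟨cuts_anti le_mergeAt hk, ?_⟩
    exact not_lt.1 fun hsk => not_top_lt (hk hleast.1 hsk)
  · rintro ⟨hk, hks⟩ x y (hxy | ⟨hx, -⟩) hxk
    · exact hk hxy hxk
    · exact absurd (hks.trans (hleast.2 ((mergeAt_apply_of_mem htop).2 hx))) hxk.not_ge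

end Cuts

section Arcs

variable {n : ℕ} {P Q : Setoid (Fin n)} {x y k : Fin n}

theorem exists_isArc_of_lt_of_le (h : P x y) (hx : x < k) (hy : k ≤ y) :
    ∃ a b, IsArc P a b ∧ P x a ∧ x ≤ a ∧ a < k ∧ k ≤ b ∧ b ≤ y := by
  obtain ⟨a, ⟨ha, hak⟩, hmax⟩ := Set.exists_max_image {i | P x i ∧ i < k} id (Set.toFinite _)
    ⟨x, P.refl' x, hx⟩
  obtain ⟨b, ⟨hb, hbk⟩, hmin⟩ := Set.exists_min_image {i | P x i ∧ k ≤ i} id (Set.toFinite _)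
    ⟨y, h, hy⟩
  refine ⟨a, b, ⟨hak.trans_le hbk, P.trans' (P.symm' ha) hb, fun i hai hib hi => ?_⟩,
    ha, hmax x ⟨P.refl' x, hx⟩, hak, hbk, hmin y ⟨h, hy⟩⟩
  rcases lt_or_ge i k with hik | hik
  · exact (hmax i ⟨P.trans' ha hi, hik⟩).not_gt hai
  · exact (hmin i ⟨P.trans' ha hi, hik⟩).not_gt hib

theorem isPlanar_iff_isNoncrossing : IsPlanar P ↔ IsNoncrossing P := by
  constructor
  · intro hP a b c d hab hbc hcd hac hbd
    by_contra hnab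
    obtain ⟨a', c', harc, haa', -, ha'b, hbc', hc'c⟩ := exists_isArc_of_lt_of_le hac hab hbc.le
    have hac' : P a c' := P.trans' haa' harc.2.1
    have hbc' : b < c' := hbc'.lt_of_ne (by rintro rfl; exact hnab hac')
    obtain ⟨b', d', harc', hbb', hb'b, hb'c', hc'd', -⟩ :=
      exists_isArc_of_lt_of_le hbd hbc' (hc'c.trans hcd.le)
    have hbd' : P b d' := P.trans' hbb' harc'.2.1
    have hc'd' : c' < d' :=
      hc'd'.lt_of_ne (by rintro rfl; exact hnab (P.trans' hac' (P.symm' hbd')))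
    exact hP a' c' b' d' harc harc' ⟨ha'b.trans_le hb'b, hb'c', hc'd'⟩
  · rintro hP a b c d hab hcd ⟨hac, hcb, hbd⟩
    exact hab.2.2 c hac hcb (hP hac hcb hbd hab.2.1 hcd.2.1)

/-- `i` and `j` are joined by an arc or by a tie. -/
def DoublePlanarPartition.Edge (R : DoublePlanarPartition n) (i j : Fin n) : Prop :=
  IsArc R.fst i j ∨ IsTie R.fst R.snd i j

theorem DoublePlanarPartition.Edge.rel_snd {R : DoublePlanarPartition n} (h : R.Edge x y) :
    R.snd x y :=
  h.elim (fun harc => R.refines harc.2.1) fun htie => htie.1.2.1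

theorem DoublePlanarPartition.exists_edge_of_lt_of_le (R : DoublePlanarPartition n)
    (h : R.snd x y) (hx : x < k) (hy : k ≤ y) : ∃ a b, R.Edge a b ∧ a < k ∧ k ≤ b := by
  obtain ⟨a, b, hab, -, -, hak, hkb, -⟩ := exists_isArc_of_lt_of_le h hx hy
  by_cases hb : ∀ i, R.fst i b → b ≤ i
  · exact ⟨a, b, .inr ⟨hab, hb⟩, hak, hkb⟩
  -- otherwise the arc of `R.fst` that ends at `b` also covers the gap before `k`
  push Not at hb
  obtain ⟨i, hi, hib⟩ := hb
  obtain ⟨c, d, hcd, -, -, hcb, hbd, hdb⟩ := exists_isArc_of_lt_of_le hi hib le_rfl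
  obtain rfl : d = b := le_antisymm hdb hbd
  refine ⟨c, d, .inl hcd, lt_of_le_of_lt ?_ hak, hkb⟩
  by_contra! hac
  exact hab.2.2 c hac hcb (R.snd.trans' hab.2.1 (R.snd.symm' (R.refines hcd.2.1)))

theorem DoublePlanarPartition.cuts_edge (R : DoublePlanarPartition n) :
    cuts R.Edge = cuts R.snd := by
  ext k
  refine ⟨fun hk x y hxy hx => ?_, fun hk x y hxy => hk hxy.rel_snd⟩
  by_contra! hy
  obtain ⟨a, b, hab, hak, hkb⟩ := R.exists_edge_of_lt_of_le hxy hx hy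
  exact (hk hab hak).not_ge hkb

end Arcs

section HalfPlane

open scoped Topology

/-- The closed half disc bounded by a semicircle. -/
def halfDisc (a b : ℝ) : Set ℂ :=
  {z | z ∈ halfPlane ∧ dist z (((a + b) / 2 : ℝ) : ℂ) ≤ (b - a) / 2}

theorem convex_halfPlane : Convex ℝ halfPlane := convex_halfSpace_im_ge 0

theorem convex_halfDisc (a b : ℝ) : Convex ℝ (halfDisc a b) :=
  convex_halfPlane.inter (convex_closedBall _ _)

theorem ofReal_mem_halfPlane (a : ℝ) : (a : ℂ) ∈ halfPlane := (Complex.ofReal_im a).ge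

theorem ofReal_mem_halfDisc {a b c : ℝ} (hac : a ≤ c) (hcb : c ≤ b) : (c : ℂ) ∈ halfDisc a b := by
  refine ⟨ofReal_mem_halfPlane c, ?_⟩
  rw [Complex.dist_of_im_eq (by simp), Complex.ofReal_re, Complex.ofReal_re, Real.dist_eq, abs_le]
  constructor <;> linarith

theorem re_mem_Icc_of_mem_halfDisc {a b : ℝ} {z : ℂ} (hz : z ∈ halfDisc a b) :
    z.re ∈ Set.Icc a b := by
  have hre : |z.re - (a + b) / 2| ≤ (b - a) / 2 := calc
    _ = |(z - (((a + b) / 2 : ℝ) : ℂ)).re| := by rw [Complex.sub_re, Complex.ofReal_re]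
    _ ≤ dist z (((a + b) / 2 : ℝ) : ℂ) :=
      (Complex.abs_re_le_norm _).trans_eq (dist_eq_norm _ _).symm
    _ ≤ (b - a) / 2 := hz.2
  rw [abs_le] at hre
  constructor <;> linarith

theorem forall_lt_of_isPreconnected {X : Type*} [TopologicalSpace X] {s : Set X}
    (hs : IsPreconnected s) {f : X → ℝ} (hf : Continuous f) {c : ℝ} (hc : ∀ x ∈ s, f x ≠ c)
    {x : X} (hx : x ∈ s) (hxc : f x < c) : ∀ y ∈ s, f y < c := by
  intro y hy
  by_contra! hcy
  obtain ⟨z, hz, hzc⟩ := hs.intermediate_value hx hy hf.continuousOn ⟨hxc.le, hcy⟩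
  exact hc z hz hzc

section Filling

variable {ι : Type*} (x : ι → ℝ) (E : ι → ι → Prop)

/-- The drawing with the points `x i` of the boundary line and a semicircle from `x i` to `x j`
whenever `E i j`. -/
def arcDiagram : Set ℂ :=
  {z | ∃ i, z = (x i : ℂ)} ∪ {z | ∃ i j, E i j ∧ z ∈ semicircle (x i) (x j)}

/-- The drawing `arcDiagram x E` with every semicircle replaced by the half disc it bounds. -/
def filledDiagram : Set ℂ :=
  {z | ∃ i, z = (x i : ℂ)} ∪ {z | ∃ i j, E i j ∧ z ∈ halfDisc (x i) (x j)}

variable {x E} {z : ℂ}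

theorem ofReal_mem_filledDiagram (i : ι) : (x i : ℂ) ∈ filledDiagram x E := .inl ⟨i, rfl⟩

theorem arcDiagram_subset_filledDiagram : arcDiagram x E ⊆ filledDiagram x E :=
  Set.union_subset_union_right _ fun _ ⟨i, j, hij, hz⟩ => ⟨i, j, hij, hz.1, hz.2.le⟩

theorem filledDiagram_subset_halfPlane : filledDiagram x E ⊆ halfPlane := by
  rintro z (⟨i, rfl⟩ | ⟨i, j, -, hz⟩)
  · exact ofReal_mem_halfPlane _
  · exact hz.1

theorem isBounded_connectedComponentIn_of_mem_halfDisc {D : Set ℂ} {a b : ℝ}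
    (hD : semicircle a b ⊆ D) (hz : z ∈ halfDisc a b) (hzD : z ∉ D) :
    Bornology.IsBounded (connectedComponentIn (halfPlane \ D) z) := by
  have hsub := connectedComponentIn_subset (halfPlane \ D) z
  refine (Metric.isBounded_ball (x := (((a + b) / 2 : ℝ) : ℂ)) (r := (b - a) / 2)).subset ?_
  exact forall_lt_of_isPreconnected isPreconnected_connectedComponentIn
    (continuous_id.dist continuous_const) (fun w hw h => (hsub hw).2 (hD ⟨(hsub hw).1, h⟩))
    (mem_connectedComponentIn ⟨hz.1, hzD⟩) (hz.2.lt_of_ne fun h => hzD (hD ⟨hz.1, h⟩))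

theorem mem_halfDisc_of_add_mul_I_mem_halfDisc {a b t : ℝ} (hz : z ∈ halfPlane) (ht : 0 ≤ t)
    (hzt : z + t * Complex.I ∈ halfDisc a b) : z ∈ halfDisc a b := by
  have him : 0 ≤ z.im := hz
  refine ⟨hz, le_trans ?_ hzt.2⟩
  rw [Complex.dist_eq_re_im, Complex.dist_eq_re_im]
  apply Real.sqrt_le_sqrt
  simp only [Complex.add_re, Complex.add_im, Complex.re_ofReal_mul, Complex.im_ofReal_mul,
    Complex.I_re, Complex.I_im, Complex.ofReal_im, mul_zero, add_zero, mul_one, sub_zero]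
  gcongr
  linarith

theorem add_mul_I_notMem_filledDiagram (hz : z ∈ halfPlane) (hzF : z ∉ filledDiagram x E) {t : ℝ}
    (ht : 0 ≤ t) : z + t * Complex.I ∉ filledDiagram x E := by
  rintro (⟨i, hi⟩ | ⟨i, j, hij, hzt⟩)
  · have himz : 0 ≤ z.im := hz
    have him : z.im + t = 0 := by simpa using congrArg Complex.im hi
    obtain rfl : t = 0 := by linarith
    exact hzF (.inl ⟨i, by simpa using hi⟩)
  · exact hzF (.inr ⟨i, j, hij, mem_halfDisc_of_add_mul_I_mem_halfDisc hz ht hzt⟩)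

theorem not_isBounded_connectedComponentIn_of_notMem_filledDiagram
    (hz : z ∈ halfPlane) (hzF : z ∉ filledDiagram x E) :
    ¬ Bornology.IsBounded (connectedComponentIn (halfPlane \ arcDiagram x E) z) := by
  intro hbounded
  have himz : 0 ≤ z.im := hz
  have hray : (fun t : ℝ => z + t * Complex.I) '' Set.Ici 0 ⊆
      connectedComponentIn (halfPlane \ arcDiagram x E) z := by
    refine IsPreconnected.subset_connectedComponentIn
      (isPreconnected_Ici.image _ (by fun_prop)) ⟨0, by simp, by simp⟩ ?_
    rintro _ ⟨t, ht, rfl⟩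
    refine ⟨?_, fun h => add_mul_I_notMem_filledDiagram hz hzF ht
      (arcDiagram_subset_filledDiagram h)⟩
    simpa [halfPlane] using add_nonneg himz ht
  obtain ⟨C, hC⟩ := (hbounded.subset hray).exists_norm_le
  have hnorm : ‖z + (|C| + 1 : ℝ) * Complex.I‖ ≤ C := hC _
    ⟨_, Set.mem_Ici.2 (by positivity), rfl⟩
  have him : |z.im + (|C| + 1)| ≤ C := by simpa using (Complex.abs_im_le_norm _).trans hnorm
  linarith [le_abs_self (z.im + (|C| + 1)), le_abs_self C]

variable (x E) in
theorem halfPlane_diff_outerRegion_arcDiagram :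
    halfPlane \ outerRegion (arcDiagram x E) = filledDiagram x E := by
  ext z
  constructor
  · rintro ⟨hz, hzU⟩
    by_contra hzF
    exact hzU ⟨⟨hz, fun hzD => hzF (arcDiagram_subset_filledDiagram hzD)⟩,
      not_isBounded_connectedComponentIn_of_notMem_filledDiagram hz hzF⟩
  · refine fun hzF => ⟨filledDiagram_subset_halfPlane hzF, fun hzU => ?_⟩
    rcases hzF with hpoint | ⟨i, j, hij, hdisc⟩
    · exact hzU.1.2 (.inl hpoint)
    · exact hzU.2 (isBounded_connectedComponentIn_of_mem_halfDisc
        (fun w hw => .inr ⟨i, j, hij, hw⟩) hdisc hzU.1.2)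

theorem connectedComponentIn_filledDiagram_eq {i j : ι} (hij : E i j) {w : ℂ}
    (hz : z ∈ halfDisc (x i) (x j)) (hw : w ∈ halfDisc (x i) (x j)) :
    connectedComponentIn (filledDiagram x E) z = connectedComponentIn (filledDiagram x E) w :=
  connectedComponentIn_eq <| (convex_halfDisc _ _).isPreconnected.subset_connectedComponentIn hz
    (fun _ hv => .inr ⟨i, j, hij, hv⟩) hw

end Filling

section Components

variable {ι : Type*} [LinearOrder ι] [Finite ι] {x : ι → ℝ} {E : ι → ι → Prop}

theorem exists_mem_cuts_connectedComponentIn_eq (hx : Monotone x) (i : ι) : ∃ k ∈ cuts E,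
    connectedComponentIn (filledDiagram x E) (x i) =
      connectedComponentIn (filledDiagram x E) (x k) := by
  induction i using WellFoundedLT.induction with
  | ind i ih =>
    by_cases hi : i ∈ cuts E
    · exact ⟨i, hi, rfl⟩
    obtain ⟨a, b, hab, hai, hib⟩ : ∃ a b, E a b ∧ a < i ∧ i ≤ b := by simpa [cuts] using hi
    obtain ⟨k, hk, hak⟩ := ih a hai
    refine ⟨k, hk, (connectedComponentIn_filledDiagram_eq hab ?_ ?_).trans hak⟩
    · exact ofReal_mem_halfDisc (hx hai.le) (hx hib)
    · exact ofReal_mem_halfDisc le_rfl (hx (hai.le.trans hib))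

theorem exists_forall_lt_and_lt (hx : StrictMono x) (k : ι) :
    ∃ c, (∀ i < k, x i < c) ∧ c < x k := by
  have hlt : ∀ᶠ c in 𝓝[<] x k, ∀ i, i < k → x i < c := Filter.eventually_all.2 fun i =>
    Filter.eventually_imp_distrib_left.2 fun hik =>
      Filter.Eventually.filter_mono nhdsWithin_le_nhds (eventually_gt_nhds (hx hik))
  exact (hlt.and eventually_mem_nhdsWithin).exists

theorem connectedComponentIn_ne_of_mem_cuts (hx : StrictMono x) {i k : ι} (hk : k ∈ cuts E)
    (hik : i < k) : connectedComponentIn (filledDiagram x E) (x i) ≠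
      connectedComponentIn (filledDiagram x E) (x k) := by
  intro heq
  obtain ⟨c, hlt, hck⟩ := exists_forall_lt_and_lt hx k
  have hright {j} (hj : ¬ j < k) : c < x j := hck.trans_le (hx.monotone (not_lt.1 hj))
  have hc : ∀ z ∈ filledDiagram x E, z.re ≠ c := by
    rintro z (⟨j, rfl⟩ | ⟨a, b, hab, hz⟩)
    · by_cases hj : j < k
      · exact (hlt j hj).ne
      · exact (hright hj).ne'
    · obtain ⟨haz, hzb⟩ := re_mem_Icc_of_mem_halfDisc hz
      by_cases ha : a < k
      · exact (hzb.trans_lt (hlt b (hk hab ha))).ne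
      · exact ((hright ha).trans_le haz).ne'
  have hleft := forall_lt_of_isPreconnected isPreconnected_connectedComponentIn
    Complex.continuous_re (fun z hz => hc z (connectedComponentIn_subset _ _ hz))
    (mem_connectedComponentIn (ofReal_mem_filledDiagram i)) (hlt i hik)
  exact (hleft _ (heq ▸ mem_connectedComponentIn (ofReal_mem_filledDiagram k))).not_gt hck

theorem boxes_arcDiagram (hx : StrictMono x) : boxes (arcDiagram x E) =
    (fun k => connectedComponentIn (filledDiagram x E) (x k)) '' cuts E := by
  rw [boxes, halfPlane_diff_outerRegion_arcDiagram]
  apply Set.Subset.antisymm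
  · rintro _ ⟨z, ⟨i, rfl⟩ | ⟨i, j, hij, hz⟩, rfl⟩
    · obtain ⟨k, hk, hik⟩ := exists_mem_cuts_connectedComponentIn_eq hx.monotone i
      exact ⟨k, hk, hik.symm⟩
    · obtain ⟨k, hk, hik⟩ := exists_mem_cuts_connectedComponentIn_eq hx.monotone i
      have hxij : x i ≤ x j := (re_mem_Icc_of_mem_halfDisc hz).1.trans
        (re_mem_Icc_of_mem_halfDisc hz).2
      exact ⟨k, hk, hik.symm.trans
        (connectedComponentIn_filledDiagram_eq hij (ofReal_mem_halfDisc le_rfl hxij) hz)⟩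
  · rintro _ ⟨k, -, rfl⟩
    exact ⟨_, ofReal_mem_filledDiagram k, rfl⟩

theorem ncard_boxes_arcDiagram (hx : StrictMono x) :
    (boxes (arcDiagram x E)).ncard = (cuts E).ncard := by
  rw [boxes_arcDiagram hx]
  refine Set.InjOn.ncard_image fun i hi k hk heq => ?_
  rcases lt_trichotomy i k with hik | hik | hki
  · exact absurd heq (connectedComponentIn_ne_of_mem_cuts hx hk hik)
  · exact hik
  · exact absurd heq.symm (connectedComponentIn_ne_of_mem_cuts hx hi hki)

end Components

end HalfPlane

namespace DoublePlanarPartition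

variable {n : ℕ}

theorem diagram_eq_arcDiagram (R : DoublePlanarPartition n) :
    R.diagram = arcDiagram (fun i : Fin n => ((i : ℕ) : ℝ)) R.Edge := by
  simp only [diagram, arcDiagram, Complex.ofReal_natCast, Edge]

theorem ncard_boxes_diagram (R : DoublePlanarPartition n) :
    (boxes R.diagram).ncard = (cuts R.snd).ncard := by
  rw [diagram_eq_arcDiagram, ncard_boxes_arcDiagram, R.cuts_edge]
  exact Nat.strictMono_cast.comp Fin.val_strictMono

end DoublePlanarPartition

section AddLast

variable {n : ℕ} {P Q : Setoid (Fin n)} {U : Setoid (Fin (n + 1))} {x y : Fin (n + 1)}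

/-- The partition of `Fin (n + 1)` obtained from `P` by adding the last point as a singleton. -/
def addLast (P : Setoid (Fin n)) : Setoid (Fin (n + 1)) :=
  Setoid.ker (Fin.snoc (fun i => some (Quotient.mk P i)) none :
    (i : Fin (n + 1)) → (fun _ => Option (Quotient P)) i)

theorem addLast_castSucc {i j : Fin n} : addLast P i.castSucc j.castSucc ↔ P i j := by
  rw [addLast, Setoid.ker_def, Fin.snoc_castSucc, Fin.snoc_castSucc, Option.some_inj, Quotient.eq]

theorem addLast_last : addLast P x (Fin.last n) ↔ x = Fin.last n := by
  rw [addLast, Setoid.ker_def, Fin.snoc_last]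
  cases x using Fin.lastCases <;> simp

theorem addLast_iff : addLast P x y ↔
    x = Fin.last n ∧ y = Fin.last n ∨ ∃ i j, P i j ∧ i.castSucc = x ∧ j.castSucc = y := by
  cases y using Fin.lastCases with
  | last => simp [addLast_last]
  | cast j =>
    cases x using Fin.lastCases with
    | last => simp [(addLast P).comm', addLast_last]
    | cast i => simp [addLast_castSucc]

theorem top_mem_cuts_addLast : ⊤ ∈ cuts (addLast P) := by
  intro x y hxy hx
  rcases addLast_iff.1 hxy with ⟨rfl, -⟩ | ⟨i, j, -, -, rfl⟩
  · exact absurd hx (lt_irrefl _)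
  · exact j.castSucc_lt_last

theorem comap_castSucc_addLast : (addLast P).comap Fin.castSucc = P :=
  Setoid.ext fun _ _ => addLast_castSucc

theorem addLast_comap_castSucc (hU : ⊤ ∈ cuts U) : addLast (U.comap Fin.castSucc) = U := by
  have hlast (x) : U x (Fin.last n) ↔ x = Fin.last n :=
    ⟨fun h => Fin.last_le_iff.1 (le_of_mem_cuts hU h), fun h => h ▸ U.refl' x⟩
  ext x y
  cases y using Fin.lastCases with
  | last => rw [addLast_last, hlast]
  | cast j =>
    cases x using Fin.lastCases with
    | last => rw [Setoid.comm', addLast_last, U.comm', hlast]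
    | cast i => exact addLast_castSucc

theorem addLast_mono (hPQ : P ≤ Q) : addLast P ≤ addLast Q := fun _ _ hxy =>
  addLast_iff.2 ((addLast_iff.1 hxy).imp_right fun ⟨i, j, h, he⟩ => ⟨i, j, hPQ h, he⟩)

theorem IsNoncrossing.comap {α β : Type*} [Preorder α] [Preorder β] {P : Setoid β} {f : α → β}
    (hP : IsNoncrossing P) (hf : StrictMono f) : IsNoncrossing (P.comap f) :=
  fun _ _ _ _ hab hbc hcd => hP (hf hab) (hf hbc) (hf hcd)

theorem IsNoncrossing.addLast (hP : IsNoncrossing P) : IsNoncrossing (addLast P) := by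
  intro a b c d hab hbc hcd hac hbd
  rcases addLast_iff.1 hac with ⟨rfl, -⟩ | ⟨i, k, hik, rfl, rfl⟩
  · exact absurd hab (Fin.le_last b).not_gt
  rcases addLast_iff.1 hbd with ⟨rfl, -⟩ | ⟨j, l, hjl, rfl, rfl⟩
  · exact absurd hbc (Fin.le_last _).not_gt
  · exact addLast_castSucc.2 (hP hab hbc hcd hik hjl)

theorem cuts_addLast : cuts (addLast P) = insert ⊤ (Fin.castSucc '' cuts P) := by
  ext k
  constructor
  · intro hk
    refine (eq_or_ne k ⊤).imp_right fun hne => ?_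
    obtain ⟨k, rfl⟩ := Fin.exists_castSucc_eq.2 hne
    exact ⟨k, fun i j hij hik => hk (addLast_castSucc.2 hij) hik, rfl⟩
  · rintro (rfl | ⟨k, hk, rfl⟩)
    · exact top_mem_cuts_addLast
    · intro x y hxy hxk
      rcases addLast_iff.1 hxy with ⟨rfl, -⟩ | ⟨i, j, hij, rfl, rfl⟩
      · exact absurd hxk (Fin.le_last _).not_gt
      · exact hk hij hxk

theorem ncard_cuts_addLast : (cuts (addLast P)).ncard = (cuts P).ncard + 1 := by
  rw [cuts_addLast, Set.ncard_insert_of_notMem,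
    Set.ncard_image_of_injective _ (Fin.castSucc_injective n)]
  rintro ⟨i, -, hi⟩
  exact Fin.castSucc_ne_last i hi

end AddLast

section OrderedPairs

variable {α : Type*} [LinearOrder α] {K : Set α}

/-- The pairs `(s, p)` of elements of `K` with `s ≤ p`. -/
def orderedPairs (K : Set α) : Set (α × α) :=
  {t | t.1 ∈ K ∧ t.2 ∈ K ∧ t.1 ≤ t.2}

theorem strictMonoOn_ncard_inter_Iic (hK : K.Finite) :
    StrictMonoOn (fun s => (K ∩ Set.Iic s).ncard) K := by
  intro s _ t ht hst
  refine Set.ncard_lt_ncard ?_ (hK.inter_of_left _)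
  refine ⟨Set.inter_subset_inter_right K (Set.Iic_subset_Iic.2 hst.le), fun h => ?_⟩
  exact hst.not_ge (h ⟨ht, le_rfl⟩).2

theorem bijOn_ncard_inter_Iic (hK : K.Finite) :
    Set.BijOn (fun s => (K ∩ Set.Iic s).ncard) K (Set.Icc 1 K.ncard) := by
  have hmaps : Set.MapsTo (fun s => (K ∩ Set.Iic s).ncard) K (Set.Icc 1 K.ncard) := fun s hs =>
    ⟨(Set.ncard_pos (hK.inter_of_left _)).2 ⟨s, hs, le_rfl⟩,
      Set.ncard_le_ncard Set.inter_subset_left hK⟩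
  have hinj := (strictMonoOn_ncard_inter_Iic hK).injOn
  refine ⟨hmaps, hinj, (Set.eq_of_subset_of_ncard_le hmaps.image_subset ?_).ge⟩
  rw [hinj.ncard_image, ← Finset.coe_Icc, Set.ncard_coe_finset, Nat.card_Icc]
  omega

theorem ncard_inter_Iic_add_ncard_inter_Ici (hK : K.Finite) {s : α} (hs : s ∈ K) :
    (K ∩ Set.Iic s).ncard + (K ∩ Set.Ici s).ncard = K.ncard + 1 := by
  rw [← Set.ncard_union_add_ncard_inter _ _ (hK.inter_of_left _) (hK.inter_of_left _),
    ← Set.inter_union_distrib_left, ← Set.inter_inter_distrib_left, Set.Iic_union_Ici,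
    Set.inter_univ, Set.Iic_inter_Ici, Set.Icc_self, Set.inter_singleton_of_mem hs,
    Set.ncard_singleton]

theorem ncard_orderedPairs_of_ncard_inter_Iic_eq (hK : K.Finite) {m : ℕ} (hm : 0 < m) :
    {t ∈ orderedPairs K | (K ∩ Set.Iic t.1).ncard = m}.ncard = K.ncard + 1 - m := by
  rcases lt_or_ge K.ncard m with hmK | hmK
  · have hempty : {t ∈ orderedPairs K | (K ∩ Set.Iic t.1).ncard = m} = ∅ :=
      Set.eq_empty_of_forall_notMem fun t ht =>
        (Set.ncard_le_ncard Set.inter_subset_left hK).not_gt (ht.2 ▸ hmK)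
    rw [hempty, Set.ncard_empty, Nat.sub_eq_zero_of_le hmK]
  · obtain ⟨s, hs, hrank : (K ∩ Set.Iic s).ncard = m⟩ :=
      (bijOn_ncard_inter_Iic hK).surjOn ⟨hm, hmK⟩
    have hpairs : {t ∈ orderedPairs K | (K ∩ Set.Iic t.1).ncard = m} =
        Prod.mk s '' (K ∩ Set.Ici s) := by
      ext ⟨x, y⟩
      constructor
      · rintro ⟨⟨hx, hy, hxy⟩, hrank'⟩
        obtain rfl : x = s := (bijOn_ncard_inter_Iic hK).injOn hx hs (hrank'.trans hrank.symm)
        exact ⟨y, ⟨hy, hxy⟩, rfl⟩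
      · rintro ⟨y, ⟨hy, hsy⟩, ⟨⟩⟩
        exact ⟨⟨hs, hy, hsy⟩, hrank⟩
    have hcount := ncard_inter_Iic_add_ncard_inter_Ici hK hs
    rw [hpairs, Set.ncard_image_of_injective _ (Prod.mk_right_injective s)]
    omega

end OrderedPairs

section Glue

variable {n : ℕ}

attribute [ext] DoublePlanarPartition

theorem isLeast_triple_top {α : Type*} [Preorder α] [OrderTop α] {s p : α} (hsp : s ≤ p) :
    IsLeast {s, p, ⊤} s :=
  ⟨by simp, by simp [hsp]⟩

namespace DoublePlanarPartition

variable (R : DoublePlanarPartition n) {t : Fin (n + 1) × Fin (n + 1)}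

theorem pair_subset_cuts_addLast_fst (ht : t ∈ orderedPairs (cuts (addLast R.snd))) :
    {t.2, ⊤} ⊆ cuts (addLast R.fst) :=
  Set.pair_subset (cuts_anti (addLast_mono R.refines) ht.2.1) top_mem_cuts_addLast

theorem triple_subset_cuts_addLast_snd (ht : t ∈ orderedPairs (cuts (addLast R.snd))) :
    {t.1, t.2, ⊤} ⊆ cuts (addLast R.snd) :=
  Set.insert_subset ht.1 (Set.pair_subset ht.2.1 top_mem_cuts_addLast)

/-- Add a last point to `R` in such a way that its blocks in the two partitions have the least
elements `t.2` and `t.1`. -/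
def glue (ht : t ∈ orderedPairs (cuts (addLast R.snd))) : DoublePlanarPartition (n + 1) where
  fst := mergeAt (addLast R.fst) {t.2, ⊤}
  snd := mergeAt (addLast R.snd) {t.1, t.2, ⊤}
  fst_planar := isPlanar_iff_isNoncrossing.2 <|
    (isPlanar_iff_isNoncrossing.1 R.fst_planar).addLast.mergeAt
      (R.pair_subset_cuts_addLast_fst ht)
  snd_planar := isPlanar_iff_isNoncrossing.2 <|
    (isPlanar_iff_isNoncrossing.1 R.snd_planar).addLast.mergeAt
      (R.triple_subset_cuts_addLast_snd ht)
  refines := mergeAt_mono (addLast_mono R.refines) (Set.subset_insert _ _)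

variable {R}

theorem isLeast_glue_fst (ht : t ∈ orderedPairs (cuts (addLast R.snd))) :
    IsLeast {x | (R.glue ht).fst x ⊤} t.2 :=
  isLeast_mergeAt (R.pair_subset_cuts_addLast_fst ht)
    ⟨by simp, by simp⟩ (by simp)

theorem isLeast_glue_snd (ht : t ∈ orderedPairs (cuts (addLast R.snd))) :
    IsLeast {x | (R.glue ht).snd x ⊤} t.1 :=
  isLeast_mergeAt (R.triple_subset_cuts_addLast_snd ht) (isLeast_triple_top ht.2.2) (by simp)

theorem cuts_glue_snd (ht : t ∈ orderedPairs (cuts (addLast R.snd))) :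
    cuts (R.glue ht).snd = cuts (addLast R.snd) ∩ Set.Iic t.1 :=
  cuts_mergeAt (R.triple_subset_cuts_addLast_snd ht) (isLeast_triple_top ht.2.2) (by simp)

theorem comap_cutAt_glue_fst (ht : t ∈ orderedPairs (cuts (addLast R.snd))) :
    (cutAt (R.glue ht).fst {t.2, ⊤}).comap Fin.castSucc = R.fst := by
  rw [glue, cutAt_mergeAt (R.pair_subset_cuts_addLast_fst ht), comap_castSucc_addLast]

theorem comap_cutAt_glue_snd (ht : t ∈ orderedPairs (cuts (addLast R.snd))) :
    (cutAt (R.glue ht).snd {t.1, t.2, ⊤}).comap Fin.castSucc = R.snd := by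
  rw [glue, cutAt_mergeAt (R.triple_subset_cuts_addLast_snd ht), comap_castSucc_addLast]

theorem exists_glue_eq (S : DoublePlanarPartition (n + 1)) :
    ∃ (R : DoublePlanarPartition n) (t : _) (ht : t ∈ orderedPairs (cuts (addLast R.snd))),
      R.glue ht = S := by
  have hfst := isPlanar_iff_isNoncrossing.1 S.fst_planar
  have hsnd := isPlanar_iff_isNoncrossing.1 S.snd_planar
  obtain ⟨p, hp⟩ : ∃ p, IsLeast {x | S.fst x ⊤} p := ⟨_, isLeast_csInf ⟨⊤, S.fst.refl' ⊤⟩⟩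
  obtain ⟨s, hs⟩ : ∃ s, IsLeast {x | S.snd x ⊤} s := ⟨_, isLeast_csInf ⟨⊤, S.snd.refl' ⊤⟩⟩
  have hA : ⊤ ∈ cuts (cutAt S.fst {p, ⊤}) := subset_cuts_cutAt (by simp)
  have hB : {s, p, ⊤} ⊆ cuts (cutAt S.snd {s, p, ⊤}) := subset_cuts_cutAt
  have hrefines : cutAt S.fst {p, ⊤} ≤ cutAt S.snd {s, p, ⊤} := by
    refine cutAt_le_cutAt S.refines (Set.insert_subset ?_ Set.subset_union_left)
    exact .inr (hsnd.isLeast_mem_cuts hs)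
  let R : DoublePlanarPartition n :=
    { fst := (cutAt S.fst {p, ⊤}).comap Fin.castSucc
      snd := (cutAt S.snd {s, p, ⊤}).comap Fin.castSucc
      fst_planar := isPlanar_iff_isNoncrossing.2 (hfst.cutAt.comap Fin.strictMono_castSucc)
      snd_planar := isPlanar_iff_isNoncrossing.2 (hsnd.cutAt.comap Fin.strictMono_castSucc)
      refines := fun _ _ h => hrefines h }
  have hRfst : addLast R.fst = cutAt S.fst {p, ⊤} := addLast_comap_castSucc hA
  have hRsnd : addLast R.snd = cutAt S.snd {s, p, ⊤} := addLast_comap_castSucc (hB (by simp))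
  refine ⟨R, (s, p), ?_, DoublePlanarPartition.ext ?_ ?_⟩
  · rw [hRsnd]
    exact ⟨hB (by simp), hB (by simp), hs.2 (S.refines hp.1)⟩
  · refine (congrArg (mergeAt · {p, ⊤}) hRfst).trans (mergeAt_cutAt hfst (Set.toFinite _) ?_ hp ?_)
    · simpa using hp.1
    · simp
  · refine (congrArg (mergeAt · {s, p, ⊤}) hRsnd).trans
      (mergeAt_cutAt hsnd (Set.toFinite _) ?_ hs ?_)
    · simpa using ⟨hs.1, S.refines hp.1⟩
    · simp

theorem bijective_glue (n : ℕ) : Function.Bijective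
    fun q : (Σ R : DoublePlanarPartition n, orderedPairs (cuts (addLast R.snd))) =>
      q.1.glue q.2.2 := by
  constructor
  · rintro ⟨R, ⟨⟨s, p⟩, ht⟩⟩ ⟨R', ⟨⟨s', p'⟩, ht'⟩⟩ (h : R.glue ht = R'.glue ht')
    obtain rfl : s = s' := (isLeast_glue_snd ht).unique (h ▸ isLeast_glue_snd ht')
    obtain rfl : p = p' := (isLeast_glue_fst ht).unique (h ▸ isLeast_glue_fst ht')
    obtain rfl : R = R' := DoublePlanarPartition.ext
      (by rw [← comap_cutAt_glue_fst ht, h, comap_cutAt_glue_fst ht'])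
      (by rw [← comap_cutAt_glue_snd ht, h, comap_cutAt_glue_snd ht'])
    rfl
  · intro S
    obtain ⟨R, t, ht, rfl⟩ := exists_glue_eq S
    exact ⟨⟨R, t, ht⟩, rfl⟩

end DoublePlanarPartition

end Glue

section Raney

open Finset.HasAntidiagonal (antidiagonal)

/-- The Raney number `a / (p k + a) * binom(p k + a, k)`, the coefficient of `x ^ k` in the `a`-th
power of the generating function of the Fuss-Catalan numbers. The form chosen here also gives the
right value `1` at `a = k = 0`. -/
def raney (p a : ℕ) : ℕ → ℚ
  | 0 => 1
  | k + 1 => (a : ℚ) / (k + 1) * ((p * (k + 1) + a - 1).choose k : ℚ)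

theorem raney_zero_right (p a : ℕ) : raney p a 0 = 1 := rfl

theorem raney_zero_succ (p k : ℕ) : raney p 0 (k + 1) = 0 := by simp [raney]

theorem raney_one (p n : ℕ) : raney p 1 n = fussCatalan p n := by
  cases n with
  | zero => simp [raney, fussCatalan]
  | succ k =>
    have hchoose : ((p * (k + 1) + 1 : ℕ) : ℚ) * ((p * (k + 1)).choose k : ℚ) =
        ((p * (k + 1) + 1).choose (k + 1) : ℚ) * (k + 1 : ℕ) := by
      exact_mod_cast Nat.add_one_mul_choose_eq (p * (k + 1)) k
    simp only [raney, fussCatalan, Nat.add_sub_cancel]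
    push_cast at hchoose ⊢
    field_simp
    linear_combination hchoose

theorem raney_succ_succ (d a k : ℕ) :
    raney (d + 1) (a + 1) (k + 1) = raney (d + 1) a (k + 1) + raney (d + 1) (a + (d + 1)) k := by
  cases k with
  | zero => simp [raney]
  | succ k =>
    obtain ⟨N, hN⟩ : ∃ N, N = (d + 1) * (k + 1) + d + a := ⟨_, rfl⟩
    have hpascal : ((N + 1).choose (k + 1) : ℚ) = N.choose k + N.choose (k + 1) := by
      exact_mod_cast Nat.choose_succ_succ N k
    have habsorb : (N.choose (k + 1) : ℚ) * (k + 1) =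
        N.choose k * ((d + 1) * (k + 1) + d + a - k) := by
      have hk : k ≤ N := by nlinarith
      have h := congrArg (Nat.cast (R := ℚ)) (Nat.choose_succ_right_eq N k)
      rw [Nat.cast_mul, Nat.cast_mul, Nat.cast_sub hk, hN] at h
      rw [hN]
      push_cast at h ⊢
      exact h
    simp only [raney]
    rw [show (d + 1) * (k + 1 + 1) + (a + 1) - 1 = N + 1 by rw [hN, mul_add]; omega, hpascal,
      show (d + 1) * (k + 1 + 1) + a - 1 = N by rw [hN, mul_add]; omega,
      show (d + 1) * (k + 1) + (a + (d + 1)) - 1 = N by rw [hN]; omega]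
    push_cast
    field_simp
    linear_combination habsorb

/-- The generating function `B = 1 + x * B ^ (d + 1)` of the Fuss-Catalan numbers satisfies
`B ^ q = (1 - x * B ^ d) ^ (-q)`; expand this power in the product `B ^ a * B ^ q`. -/
theorem sum_choose_mul_raney (d a q k : ℕ) :
    ∑ t ∈ antidiagonal k, ((t.1 + q - 1).choose t.1 : ℚ) * raney (d + 1) (a + d * t.1) t.2 =
      raney (d + 1) (a + q) k := by
  induction q generalizing a k with
  | zero =>
    cases k with
    | zero => simp
    | succ k => simp [Finset.Nat.sum_antidiagonal_succ]
  | succ q ihq =>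
    induction k generalizing a with
    | zero => simp [raney_zero_right]
    | succ k ihk =>
      have hpascal (i : ℕ) : ((i + 1 + (q + 1) - 1).choose (i + 1) : ℚ) =
          (i + (q + 1) - 1).choose i + (i + 1 + q - 1).choose (i + 1) := by
        rw [show i + 1 + (q + 1) - 1 = i + q + 1 by omega, Nat.choose_succ_succ]
        push_cast
        congr 3
        omega
      have hfst := ihk (a + d)
      have hsnd := ihq a (k + 1)
      rw [Finset.Nat.sum_antidiagonal_succ] at hsnd ⊢
      simp only [hpascal, add_mul, Finset.sum_add_distrib]
      rw [show a + (q + 1) = a + q + 1 by ring, raney_succ_succ, ← hsnd,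
        show a + q + (d + 1) = a + d + (q + 1) by ring, ← hfst]
      simp only [mul_add, mul_one, ← add_assoc, add_right_comm a d]
      simp only [zero_add, add_tsub_cancel_right, Nat.choose_zero_right, Nat.cast_one, mul_zero,
        add_zero, one_mul, Nat.succ_add_sub_one]
      ring

theorem fussCatalanTriangle_eq_raney (d m k : ℕ) :
    (fussCatalanTriangle (d + 1) (m + k) k : ℚ) = raney (d + 1) (d * m) k := by
  induction hn : m + k generalizing m k with
  | zero =>
    obtain ⟨rfl, rfl⟩ : m = 0 ∧ k = 0 := by omega
    simp [fussCatalanTriangle, raney_zero_right]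
  | succ n ih =>
    cases m with
    | zero =>
      obtain rfl : k = n + 1 := by omega
      simp [fussCatalanTriangle, raney_zero_succ]
    | succ m =>
      rw [fussCatalanTriangle, if_pos (by omega), mul_add, mul_one, ← sum_choose_mul_raney,
        ← Finset.Nat.sum_antidiagonal_swap, Finset.Nat.sum_antidiagonal_eq_sum_range_succ_mk]
      push_cast
      refine Finset.sum_congr rfl fun j hj => ?_
      have hj : j ≤ k := Finset.mem_range_succ_iff.1 hj
      rw [ih (m + (k - j)) j (by omega), mul_add]
      rfl

theorem sum_fussCatalanTriangle (d n : ℕ) :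
    ∑ k ∈ Finset.range (n + 1), (fussCatalanTriangle (d + 1) n k : ℚ) =
      fussCatalan (d + 1) n := by
  rw [← raney_one, ← Nat.zero_add 1, ← sum_choose_mul_raney d 0 1 n,
    ← Finset.Nat.sum_antidiagonal_swap, Finset.Nat.sum_antidiagonal_eq_sum_range_succ_mk]
  refine Finset.sum_congr rfl fun k hk => ?_
  have hk : k ≤ n := Finset.mem_range_succ_iff.1 hk
  have htri := fussCatalanTriangle_eq_raney d (n - k) k
  rw [Nat.sub_add_cancel hk] at htri
  simp [htri]

end Raney

section Counting

theorem fussCatalanTriangle_three_succ {n k : ℕ} (hk : k ≤ n) :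
    fussCatalanTriangle 3 (n + 1) k =
      ∑ j ∈ Finset.range (k + 1), (k - j + 1) * fussCatalanTriangle 3 n j := by
  rw [fussCatalanTriangle, if_pos (Nat.lt_succ_of_le hk)]
  simp only [show ∀ i, i + 3 - 2 = i + 1 from fun _ => rfl, Nat.choose_succ_self_right]

namespace DoublePlanarPartition

variable {n : ℕ}

instance (n : ℕ) : Finite (DoublePlanarPartition n) :=
  Finite.of_injective (fun R : DoublePlanarPartition n => (⇑R.fst, ⇑R.snd)) fun _ _ h =>
    DoublePlanarPartition.ext (Setoid.eq_iff_rel_eq.2 (congrArg Prod.fst h))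
      (Setoid.eq_iff_rel_eq.2 (congrArg Prod.snd h))

noncomputable instance (n : ℕ) : Fintype (DoublePlanarPartition n) := Fintype.ofFinite _

theorem ncard_cuts_snd_le (R : DoublePlanarPartition n) : (cuts R.snd).ncard ≤ n :=
  (Set.ncard_le_card _).trans_eq (Nat.card_fin n)

theorem card_ncard_cuts_eq_sum (n : ℕ) {m : ℕ} (hm : 0 < m) :
    Nat.card {S : DoublePlanarPartition (n + 1) // (cuts S.snd).ncard = m} =
      ∑ R : DoublePlanarPartition n, ((cuts R.snd).ncard + 2 - m) := by
  let K (R : DoublePlanarPartition n) := cuts (addLast R.snd)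
  let e : {S : DoublePlanarPartition (n + 1) // (cuts S.snd).ncard = m} ≃
      Σ R, {t ∈ orderedPairs (K R) | (K R ∩ Set.Iic t.1).ncard = m} :=
    ((Equiv.ofBijective _ (bijective_glue n)).subtypeEquiv fun q => by
      rw [Equiv.ofBijective_apply, cuts_glue_snd q.2.2]).symm.trans
    { toFun q := ⟨q.1.1, q.1.2, q.1.2.2, q.2⟩
      invFun q := ⟨⟨q.1, q.2, q.2.2.1⟩, q.2.2.2⟩
      left_inv _ := rfl
      right_inv _ := rfl }
  rw [Nat.card_congr e, Nat.card_sigma]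
  refine Finset.sum_congr rfl fun R _ => ?_
  rw [Nat.card_coe_set_eq, ncard_orderedPairs_of_ncard_inter_Iic_eq (Set.toFinite _) hm,
    ncard_cuts_addLast]

theorem sum_ncard_cuts_eq_sum_range {M : Type*} [AddCommMonoid M] (n : ℕ) (f : ℕ → M) :
    ∑ R : DoublePlanarPartition n, f (n - (cuts R.snd).ncard) =
      ∑ j ∈ Finset.range (n + 1),
        Nat.card {R : DoublePlanarPartition n // (cuts R.snd).ncard = n - j} • f j := by
  classical
  rw [← Finset.sum_fiberwise_of_maps_to (t := Finset.range (n + 1))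
    (g := fun R : DoublePlanarPartition n => n - (cuts R.snd).ncard)
    fun R _ => Finset.mem_range_succ_iff.2 (Nat.sub_le _ _)]
  refine Finset.sum_congr rfl fun j hj => ?_
  have hj : j ≤ n := Finset.mem_range_succ_iff.1 hj
  have hiff (R : DoublePlanarPartition n) :
      n - (cuts R.snd).ncard = j ↔ (cuts R.snd).ncard = n - j := by
    have := R.ncard_cuts_snd_le
    omega
  rw [Finset.sum_congr rfl fun R hR => congrArg f (Finset.mem_filter.1 hR).2, Finset.sum_const,
    Nat.card_eq_fintype_card, Fintype.card_subtype]
  simp only [hiff]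

theorem card_ncard_cuts_succ {k : ℕ} (hk : k ≤ n) :
    Nat.card {S : DoublePlanarPartition (n + 1) // (cuts S.snd).ncard = n + 1 - k} =
      ∑ j ∈ Finset.range (k + 1),
        (k - j + 1) * Nat.card {R : DoublePlanarPartition n // (cuts R.snd).ncard = n - j} :=
  calc
    _ = ∑ R : DoublePlanarPartition n, (k + 1 - (n - (cuts R.snd).ncard)) := by
      rw [card_ncard_cuts_eq_sum n (Nat.sub_pos_of_lt (Nat.lt_succ_of_le hk))]
      refine Finset.sum_congr rfl fun R _ => ?_
      have := R.ncard_cuts_snd_le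
      omega
    _ = ∑ j ∈ Finset.range (n + 1),
        (k + 1 - j) * Nat.card {R : DoublePlanarPartition n // (cuts R.snd).ncard = n - j} := by
      rw [sum_ncard_cuts_eq_sum_range n (k + 1 - ·)]
      exact Finset.sum_congr rfl fun j _ => mul_comm _ _
    _ = ∑ j ∈ Finset.range (k + 1),
        (k + 1 - j) * Nat.card {R : DoublePlanarPartition n // (cuts R.snd).ncard = n - j} := by
      refine (Finset.sum_subset (Finset.range_mono (Nat.succ_le_succ hk)) fun j _ hj => ?_).symm
      rw [Nat.sub_eq_zero_of_le (not_lt.1 fun h => hj (Finset.mem_range.2 h)), zero_mul]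
    _ = _ := Finset.sum_congr rfl fun j hj => by
      rw [Nat.sub_add_comm (Finset.mem_range_succ_iff.1 hj)]

instance : Unique (DoublePlanarPartition 0) where
  default := ⟨⊥, ⊥, finZeroElim, finZeroElim, le_rfl⟩
  uniq _ := DoublePlanarPartition.ext (Setoid.ext finZeroElim) (Setoid.ext finZeroElim)

theorem card_ncard_cuts_eq_fussCatalanTriangle {k : ℕ} (hk : k ≤ n) :
    Nat.card {R : DoublePlanarPartition n // (cuts R.snd).ncard = n - k} =
      fussCatalanTriangle 3 n k := by
  induction n generalizing k with
  | zero =>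
    have hzero (R : DoublePlanarPartition 0) : (cuts R.snd).ncard = 0 :=
      Nat.le_zero.1 R.ncard_cuts_snd_le
    simp [fussCatalanTriangle, hzero, Nat.le_zero.1 hk]
  | succ n ih =>
    rcases hk.eq_or_lt with rfl | hk
    · have hpos (R : DoublePlanarPartition (n + 1)) : (cuts R.snd).ncard ≠ 0 :=
        Set.ncard_ne_zero_of_mem (a := 0) fun x y _ hx => absurd hx (Fin.not_lt_zero x)
      simp [fussCatalanTriangle, hpos]
    · have hk : k ≤ n := Nat.le_of_lt_succ hk
      rw [card_ncard_cuts_succ hk, fussCatalanTriangle_three_succ hk]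
      refine Finset.sum_congr rfl fun j hj => ?_
      rw [ih ((Finset.mem_range_succ_iff.1 hj).trans hk)]

theorem card_eq_fussCatalan (n : ℕ) :
    (Nat.card (DoublePlanarPartition n) : ℚ) = fussCatalan 3 n := by
  calc _ = ∑ R : DoublePlanarPartition n, (1 : ℕ → ℚ) (n - (cuts R.snd).ncard) := by simp
    _ = ∑ k ∈ Finset.range (n + 1), (fussCatalanTriangle 3 n k : ℚ) := by
      rw [sum_ncard_cuts_eq_sum_range]
      refine Finset.sum_congr rfl fun k hk => ?_
      rw [card_ncard_cuts_eq_fussCatalanTriangle (Finset.mem_range_succ_iff.1 hk)]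
      simp
    _ = fussCatalan 3 n := sum_fussCatalanTriangle 2 n

end DoublePlanarPartition

end Counting

theorem mainTheorem3 (n : ℕ) :
    (∀ k : ℕ, k ≤ n →
      Nat.card {R : DoublePlanarPartition n // (boxes R.diagram).ncard = n - k} =
        fussCatalanTriangle 3 n k) ∧
    (Nat.card (DoublePlanarPartition n) : ℚ) = fussCatalan 3 n := by
  refine ⟨fun k hk => ?_, DoublePlanarPartition.card_eq_fussCatalan n⟩
  simp only [DoublePlanarPartition.ncard_boxes_diagram]
  exact DoublePlanarPartition.card_ncard_cuts_eq_fussCatalanTriangle hk
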